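/- **Conventions.** For topological spaces $X,Y$, a map $f:\mathrm{Closed}(X)\to\mathrm{Closed}(Y)$ is *admissible* if $f(\emptyset)=\emptyset$ and $f(A\cup B)=f(A)\cup f(B)$; $X+_fY$ is the disjoint union of $X$ and $Y$ in which $A$ is closed iff $A\cap X$ is closed in $X$, $A\cap Y$ is closed in $Y$ and $f(A\cap X)\subseteq A$. For maps $a$ of $X$ and $b$ of $Y$, $a+b$ denotes the map of $X+_fY$ equal to $a$ on $X$ and to $b$ on $Y$. Let a group $G$ act properly discontinuously and cocompactly on a locally compact Hausdorff space $X$ by $\varphi$ (properly discontinuously: $\{g: gK\cap L\ne\emptyset\}$ is finite for all compact $K,L\subseteq X$), and let $\psi$ be an action of $G$ by homeomorphisms on a compact Hausdorff space $Y$. * $X+_fY$, with $\varphi+\psi$, is in $\mathrm{Pers}(\varphi)$ (is *perspective*) if it is compact Hausdorff, $\varphi+\psi$ acts on it by homeomorphisms, and for every entourage $u$ of its unique compatible uniform structure and every compact $K\subseteq X$ the set $\{g\in G: gK\times gK\not\subseteq u\}$ is finite. * For an admissible map $\partial:\mathrm{Closed}(G)\to\mathrm{Closed}(Y)$, where $G$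 is discrete, $G+_\partial Y$, with $L+\psi$ ($L$ the left multiplication action), is in $\mathrm{Pers}(G)$ if it is compact Hausdorff and both $L+\psi$ and $R+\mathrm{id}$ ($R$ the right multiplication action) are continuous on it. **CAT(0) compactification.** Let $X$ be a CAT(0) space and $x\in X$. For $r>0$ let $\pi_r$ be the radial projection of $X$ onto the closed ball $\bar B(x,r)$ along geodesics issuing from $x$. The inverse limit of the balls $\bar B(x,r)$, $r>0$, with the bonding maps $\pi_s|_{\bar B(x,r)}$, $s<r$, is the disjoint union of $X$ (embedded by $y\mapsto(\pi_r(y))_r$) and the visual boundary $\partial X$, the set of geodesic rays issuing from $x$; it is $X+_f\partial X$ with $f(A)$ the set of points of $\partial X$ in the closure of $A$. **Proposition.** Let $X$ be a proper CAT(0) space, $x\in X$, and let $\varphi$ be a properly discontinuous and cocompact action of a group $G$ on $X$ by isometries. Then there is an action $\psi$ of $G$ by homeomorphisms on $\partial X$, where $\psi(g)\xi$ is the ray issuing from $x$ at bounded distance from the ray $g\xi$, such that 1. $X+_f\partial X$, with $\varphi+\psi$, is in $\mathrm{Pers}(\varphi)$; 2. for every compact $K\subseteq X$ with $GK=X$,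 the space $G+_{f_{\Lambda_K}}\partial X$, with $L+\psi$, is in $\mathrm{Pers}(G)$, where $f_{\Lambda_K}(F)=f(FK)$ for $F\subseteq G$; so $\partial X$ is also a boundary of $G$ in $\mathrm{Pers}(G)$. -/

import Mathlib

open Set Metric TopologicalSpace

/-! ### Sums of spaces `X +_f Y` along an admissible map -/

/-- An admissible map `f : Closed(X) → Closed(Y)`: `f ∅ = ∅` and `f (A ∪ B) = f A ∪ f B`. -/
abbrev AdmissibleMap (X Y : Type*) [TopologicalSpace X] [TopologicalSpace Y] :=
  SupBotHom (Closeds X) (Closeds Y)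

/-- The underlying set of `X +_f Y`, the disjoint union of `X` and `Y`. -/
def SumSpace {X Y : Type*} [TopologicalSpace X] [TopologicalSpace Y] (_f : AdmissibleMap X Y) :
    Type _ :=
  X ⊕ Y

namespace SumSpace

variable {X Y : Type*} [TopologicalSpace X] [TopologicalSpace Y] (f : AdmissibleMap X Y)

/-- The inclusion of `X` in `X +_f Y`. -/
def inl (p : X) : SumSpace f := Sum.inl p

/-- The inclusion of `Y` in `X +_f Y`. -/
def inr (q : Y) : SumSpace f := Sum.inr q

/-- The closed subsets of `X +_f Y`: those `A` with `A ∩ X` closed in `X`, `A ∩ Y` closed in `Y`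
and `f (A ∩ X) ⊆ A`. -/
def IsClosedSet (A : Set (SumSpace f)) : Prop :=
  ∃ h : IsClosed (inl f ⁻¹' A), IsClosed (inr f ⁻¹' A) ∧
    (f ⟨inl f ⁻¹' A, h⟩ : Set Y) ⊆ inr f ⁻¹' A

/-- The topology `τ_f`. -/
instance instTopologicalSpace : TopologicalSpace (SumSpace f) :=
  TopologicalSpace.ofClosed {A | IsClosedSet f A}
    (by
      have h : IsClosed (inl f ⁻¹' (∅ : Set (SumSpace f))) := by simp
      refine ⟨h, by simp, ?_⟩
      have h0 : (⟨inl f ⁻¹' (∅ : Set (SumSpace f)), h⟩ : Closeds X) = ⊥ := by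
        ext; simp
      rw [h0, map_bot]
      simp)
    (by
      intro S hS
      have h : IsClosed (inl f ⁻¹' (⋂₀ S)) := by
        rw [preimage_sInter]
        exact isClosed_biInter fun A hA => (hS hA).1
      refine ⟨h, ?_, ?_⟩
      · rw [preimage_sInter]
        exact isClosed_biInter fun A hA => (hS hA).2.1
      · intro q hq A hA
        obtain ⟨hA1, _, hA3⟩ := hS hA
        refine hA3 ?_
        have hle : (⟨inl f ⁻¹' (⋂₀ S), h⟩ : Closeds X) ≤ ⟨inl f ⁻¹' A, hA1⟩ :=
          fun p hp => hp A hA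
        exact OrderHomClass.mono f hle hq)
    (by
      rintro A ⟨hA1, hA2, hA3⟩ B ⟨hB1, hB2, hB3⟩
      have h : IsClosed (inl f ⁻¹' (A ∪ B)) := hA1.union hB1
      refine ⟨h, hA2.union hB2, ?_⟩
      have hs : (⟨inl f ⁻¹' (A ∪ B), h⟩ : Closeds X)
          = ⟨inl f ⁻¹' A, hA1⟩ ⊔ ⟨inl f ⁻¹' B, hB1⟩ := rfl
      rw [hs, map_sup]
      exact union_subset_union hA3 hB3)

theorem isClosed_iff {A : Set (SumSpace f)} : IsClosed A ↔ IsClosedSet f A := by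
  rw [← isOpen_compl_iff]
  change IsClosedSet f Aᶜᶜ ↔ _
  rw [compl_compl]

variable {f}

/-- The map `a + b : X +_f Y → X +_f Y` which is `a` on `X` and `b` on `Y`. -/
def map (a : X → X) (b : Y → Y) : SumSpace f → SumSpace f := Sum.map a b

end SumSpace

/-! ### Perspectivity -/

/-- `X +_f Y`, with the action `φ + ψ` of `G`, is an object of `Pers(φ)`, where `φ` is the given
action of `G` on `X`: `Y` is compact Hausdorff, `X +_f Y` is compact Hausdorff, `G` acts on it by
homeomorphisms through `φ + ψ`, and for every entourage `u` of the uniform structure of `X +_f Y`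
and every compact `K ⊆ X`, only finitely many translates `g K` are not `u`-small.
(On a compact Hausdorff space there is exactly one compatible uniform structure.) -/
structure IsPerspective {G X Y : Type*} [Group G] [TopologicalSpace X] [MulAction G X]
    [TopologicalSpace Y] (f : AdmissibleMap X Y) (ψ : G →* (Y ≃ₜ Y)) : Prop where
  compact_boundary : CompactSpace Y
  t2_boundary : T2Space Y
  compact : CompactSpace (SumSpace f)
  t2 : T2Space (SumSpace f)
  isHomeomorph : ∀ g : G,
    IsHomeomorph (SumSpace.map (fun p : X => g • p) (ψ g) : SumSpace f → SumSpace f)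
  finite_not_small : ∀ 𝒰 : UniformSpace (SumSpace f),
    𝒰.toTopologicalSpace = SumSpace.instTopologicalSpace f →
    ∀ u ∈ @uniformity (SumSpace f) 𝒰, ∀ K : Set X, IsCompact K →
      {g : G | ¬ ∀ k ∈ K, ∀ k' ∈ K,
        (SumSpace.inl f (g • k), SumSpace.inl f (g • k')) ∈ u}.Finite

/-- `G +_∂ Y`, with the action `L + ψ` of the discrete group `G`, is an object of `Pers(G)`:
`Y` and `G +_∂ Y` are compact Hausdorff, and both the left action `L + ψ` and the right
multiplication action `R + id` on `G +_∂ Y` are continuous. -/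
structure IsPerspectiveGroup {G Y : Type*} [Group G] [TopologicalSpace G] [DiscreteTopology G]
    [TopologicalSpace Y] (f : AdmissibleMap G Y) (ψ : G →* (Y ≃ₜ Y)) : Prop where
  compact_boundary : CompactSpace Y
  t2_boundary : T2Space Y
  compact : CompactSpace (SumSpace f)
  t2 : T2Space (SumSpace f)
  continuous_left : Continuous fun p : G × SumSpace f =>
    (SumSpace.map (fun h : G => p.1 * h) (ψ p.1) p.2 : SumSpace f)
  continuous_right : Continuous fun p : G × SumSpace f =>
    (SumSpace.map (fun h : G => h * p.1) id p.2 : SumSpace f)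

/-- A compact set whose translates cover the space. -/
def IsCompactFundamentalDomain (G : Type*) {X : Type*} [Group G] [TopologicalSpace X] [MulAction G X]
    (K : Set X) : Prop :=
  IsCompact K ∧ ∀ p : X, ∃ g : G, ∃ k ∈ K, g • k = p

/-- The union of the translates of a compact set by any set of elements of a properly
discontinuous group is closed. -/
theorem isClosed_iUnion_translates {G X : Type*} [Group G] [TopologicalSpace X] [T2Space X]
    [LocallyCompactSpace X] [MulAction G X] [ContinuousConstSMul G X]
    [ProperlyDiscontinuousSMul G X] {K : Set X} (hK : IsCompact K) (F : Set G) :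
    IsClosed (⋃ g : F, (fun p : X => (g : G) • p) '' K) := by
  refine LocallyFinite.isClosed_iUnion ?_ fun g =>
    (hK.image (continuous_const_smul (g : G))).isClosed
  intro p
  obtain ⟨L, hL, hp⟩ := exists_compact_mem_nhds p
  refine ⟨L, hp, ?_⟩
  have hfin : {g : G | ((fun p : X => g • p) '' K ∩ L).Nonempty}.Finite :=
    ProperlyDiscontinuousSMul.finite_disjoint_inter_image hK hL
  exact Set.Finite.preimage (f := (Subtype.val : F → G)) Subtype.val_injective.injOn hfin

/-- The admissible map `Λ_K : Closed(G) → Closed(X)`, `F ↦ F K`. -/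
def translatesMap (G : Type*) {X : Type*} [Group G] [TopologicalSpace G] [TopologicalSpace X]
    [T2Space X] [LocallyCompactSpace X] [MulAction G X] [ContinuousConstSMul G X]
    [ProperlyDiscontinuousSMul G X] (K : Set X) (hK : IsCompact K) : AdmissibleMap G X where
  toFun F := ⟨⋃ g : (F : Set G), (fun p : X => (g : G) • p) '' K,
    isClosed_iUnion_translates hK (F : Set G)⟩
  map_sup' A B := by
    ext p
    simp only [Closeds.coe_sup, iUnion_coe_set, biUnion_union, SetLike.mem_coe]
    rfl
  map_bot' := by
    ext p
    simp

/-! ### CAT(0) spaces -/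

/-- `γ`, restricted to `[0, d(p, q)]`, is a geodesic path from `p` to `q`. -/
def IsGeodesicPath {X : Type*} [MetricSpace X] (γ : ℝ → X) (p q : X) : Prop :=
  γ 0 = p ∧ γ (dist p q) = q ∧
    ∀ s ∈ Icc 0 (dist p q), ∀ t ∈ Icc 0 (dist p q), dist (γ s) (γ t) = |s - t|

/-- `X` is a CAT(0) space: it is a geodesic space, and in every geodesic triangle the distance of
two points on two sides is at most the distance of the comparison points in a Euclidean comparison
triangle. (The two sides issue from a common vertex `p`; the points lie at distances `s`, `t` from
`p`.) -/
structure IsCAT0 (X : Type*) [MetricSpace X] : Prop where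
  exists_geodesic : ∀ p q : X, ∃ γ : ℝ → X, IsGeodesicPath γ p q
  comparison : ∀ (p q r : X) (γ δ : ℝ → X), IsGeodesicPath γ p q → IsGeodesicPath δ p r →
    ∀ p' q' r' : EuclideanSpace ℝ (Fin 2),
      dist p' q' = dist p q → dist p' r' = dist p r → dist q' r' = dist q r →
      ∀ s ∈ Icc 0 (dist p q), ∀ t ∈ Icc 0 (dist p r),
        dist (γ s) (δ t) ≤
          dist (AffineMap.lineMap p' q' (s / dist p q) : EuclideanSpace ℝ (Fin 2))
            (AffineMap.lineMap p' r' (t / dist p r))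

/-- Geodesics in a CAT(0) space are unique. -/
theorem IsCAT0.geodesic_unique {X : Type*} [MetricSpace X] (hX : IsCAT0 X) {p q : X}
    {γ δ : ℝ → X} (hγ : IsGeodesicPath γ p q) (hδ : IsGeodesicPath δ p q) {s : ℝ}
    (hs : s ∈ Icc 0 (dist p q)) : γ s = δ s := by
  have h := hX.comparison p q q γ δ hγ hδ 0 (EuclideanSpace.single 0 (dist p q))
    (EuclideanSpace.single 0 (dist p q)) (by simp) (by simp) (by simp) s hs s hs
  rw [dist_self] at h
  exact dist_le_zero.1 h

/-! ### The compactification by the visual boundary -/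

open Classical in
/-- The radial projection `π_s` to the closed ball of radius `s` about `x`: it fixes this ball, and
sends a point `y` outside it to the point at distance `s` from `x` on the geodesic `[x, y]`.
(It is meant for geodesic spaces with unique geodesics.) -/
noncomputable def radialProj {X : Type*} [MetricSpace X] (x : X) (s : ℝ) (y : X) : X :=
  if h : s < dist x y ∧ ∃ γ : ℝ → X, IsGeodesicPath γ x y then Classical.choose h.2 s else y

theorem radialProj_of_le {X : Type*} [MetricSpace X] {x y : X} {s : ℝ} (h : dist x y ≤ s) :
    radialProj x s y = y := by
  rw [radialProj, dif_neg fun h' => absurd h'.1 (not_lt.2 h)]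

theorem IsCAT0.radialProj_eq {X : Type*} [MetricSpace X] (hX : IsCAT0 X) {x y : X} {s : ℝ}
    (hs : 0 ≤ s) (h : s < dist x y) {γ : ℝ → X} (hγ : IsGeodesicPath γ x y) :
    radialProj x s y = γ s := by
  have h' : s < dist x y ∧ ∃ γ : ℝ → X, IsGeodesicPath γ x y := ⟨h, γ, hγ⟩
  rw [radialProj, dif_pos h']
  exact hX.geodesic_unique (Classical.choose_spec h'.2) hγ ⟨hs, h.le⟩

/-- The inverse limit of the closed balls of radius `r > 0` about `x` with the radial projections
`π_{rs}`, `s < r`, as bonding maps; it carries the topology induced from the product. -/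
def visualLimit {X : Type*} [MetricSpace X] (x : X) : Set (Ioi (0 : ℝ) → X) :=
  {c | (∀ r : Ioi (0 : ℝ), c r ∈ closedBall x (r : ℝ)) ∧
    ∀ r s : Ioi (0 : ℝ), s < r → radialProj x (s : ℝ) (c r) = c s}

/-- The visual boundary `∂X` seen from `x`: the points `c` of the limit with `d(x, c r) = r` for
all `r`, that is, the geodesic rays `r ↦ c r` issuing from `x`. These are the points of the limit
which do not come from a point of `X`. The topology is the subspace topology (cone topology). -/
def visualBoundary {X : Type*} [MetricSpace X] (x : X) : Set (Ioi (0 : ℝ) → X) :=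
  {c | c ∈ visualLimit x ∧ ∀ r : Ioi (0 : ℝ), dist x (c r) = r}

/-- The inclusion of `X` in the limit. -/
noncomputable def toVisualLimit {X : Type*} [MetricSpace X] (x y : X) : Ioi (0 : ℝ) → X :=
  fun r => radialProj x (r : ℝ) y

/-- The admissible map `f` for which `X +_f ∂X` is the compactification of `X` by its visual
boundary: `f A` is the set of boundary points in the closure of `A` in the limit space. -/
noncomputable def visualMap {X : Type*} [MetricSpace X] (x : X) :
    AdmissibleMap X (visualBoundary x) where
  toFun A := ⟨{ξ | (ξ : Ioi (0 : ℝ) → X) ∈ closure (toVisualLimit x '' (A : Set X))},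
    isClosed_closure.preimage continuous_subtype_val⟩
  map_sup' A B := by
    ext ξ
    simp only [Closeds.coe_sup, image_union, closure_union]
    rfl
  map_bot' := by
    ext ξ
    simp

/-!
The CAT(0) inequality, written with the law of cosines, bounds the distance of two points on two
sides of a triangle (`IsCAT0.dist_sq_le`). It has three consequences for the radial projection
`π_r` about `x`: it is 1-Lipschitz, it shrinks distances between points far from `x` by the factor
`r / M`, where `M` bounds their distance to `x` from below, and it moves by at most `d(x, x')` when
its centre moves from `x` to `x'`. Combining the last two, the projection of a far away point `y`
to a large ball about `x` and `y` itself are seen from `x'` in almost the same direction, uniformly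
in `y` (`IsCAT0.dist_radialProj_changeCentre_le`).

The space `X +_f ∂X` is homeomorphic to the inverse limit of the balls about `x`
(`IsCAT0.isClosedEmbedding_sumToLimit`), hence compact Hausdorff. For `g` in `G` and a point `c` of
the limit, the change of centre estimate, applied to `g x` and `x`, shows that `π_r (g c(n))`
converges as `n → ∞`, uniformly in `c`. The limits define a continuous extension of `g` to the
inverse limit, which moves rays to asymptotic rays (`IsCAT0.exists_extension`). Since `X` is dense,
these extensions compose as the elements of `G` do, and so give the action `ψ` on `∂X`.

Everything else follows from the shrinking of distances. By proper discontinuity the translates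
`g K` of a compact set leave every ball, so they become small in the inverse limit; this is
perspectivity, as the uniform structure of a compact space is unique. In the same way the boundary
points in the closure of `A ⊆ X` depend on `A` only up to bounded distance
(`IsCAT0.visualMap_le_of_dist_le`). So for `k₀ ∈ K` the map `G +_∂ ∂X → X +_f ∂X` which is
`g ↦ g k₀` on `G` and the identity on `∂X` is continuous; it is closed with finite fibres, hence
proper, and it transports compactness and the separation of points. Right multiplication by `h`
moves the sets `F K` by a bounded distance, so it extends by the identity of `∂X`.
-/

open Filter Topology

/-! ### Geodesics and comparison triangles -/

namespace IsGeodesicPath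

variable {X : Type*} [MetricSpace X] {γ : ℝ → X} {p q : X}

theorem dist_left (h : IsGeodesicPath γ p q) {s : ℝ} (hs : s ∈ Icc 0 (dist p q)) :
    dist p (γ s) = s := by
  have := h.2.2 0 ⟨le_rfl, dist_nonneg⟩ s hs
  rwa [h.1, zero_sub, abs_neg, abs_of_nonneg hs.1] at this

theorem dist_right (h : IsGeodesicPath γ p q) {s : ℝ} (hs : s ∈ Icc 0 (dist p q)) :
    dist (γ s) q = dist p q - s := by
  have := h.2.2 s hs (dist p q) ⟨dist_nonneg, le_rfl⟩
  rwa [h.2.1, abs_sub_comm, abs_of_nonneg (sub_nonneg.2 hs.2)] at this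

theorem restrict (h : IsGeodesicPath γ p q) {s : ℝ} (hs : s ∈ Icc 0 (dist p q)) :
    IsGeodesicPath γ p (γ s) := by
  have hd := h.dist_left hs
  refine ⟨h.1, by rw [hd], fun a ha b hb => h.2.2 a ?_ b ?_⟩
  · rw [hd] at ha; exact ⟨ha.1, ha.2.trans hs.2⟩
  · rw [hd] at hb; exact ⟨hb.1, hb.2.trans hs.2⟩

theorem reverse (h : IsGeodesicPath γ p q) :
    IsGeodesicPath (fun s => γ (dist p q - s)) q p := by
  refine ⟨by simpa using h.2.1, by simpa [dist_comm q p] using h.1, fun a ha b hb => ?_⟩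
  rw [dist_comm q p] at ha hb
  rw [h.2.2 _ ⟨by linarith [ha.2], by linarith [ha.1]⟩ _ ⟨by linarith [hb.2], by linarith [hb.1]⟩,
    abs_sub_comm]
  congr 1
  ring

theorem smul {G : Type*} [Group G] [MulAction G X] [IsIsometricSMul G X]
    (h : IsGeodesicPath γ p q) (g : G) : IsGeodesicPath (fun s => g • γ s) (g • p) (g • q) := by
  refine ⟨by simp [h.1], by simp [h.2.1], ?_⟩
  simpa using h.2.2

end IsGeodesicPath

/-- A Euclidean triangle with one vertex at the origin and prescribed side lengths. -/
theorem exists_comparison_triangle {a b c : ℝ} (ha : 0 < a) (hb : 0 < b) (hc : 0 ≤ c)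
    (hab : (a - b) ^ 2 ≤ c ^ 2) (habc : c ≤ a + b) :
    ∃ u v : EuclideanSpace ℝ (Fin 2), dist 0 u = a ∧ dist 0 v = b ∧ dist u v = c ∧
      ∀ s t : ℝ, dist ((s / a) • u) ((t / b) • v) ^ 2 =
        (s - t) ^ 2 + s * t / (a * b) * (c ^ 2 - (a - b) ^ 2) := by
  -- `k` is the abscissa of the third vertex, by the law of cosines.
  set k : ℝ := (a ^ 2 + b ^ 2 - c ^ 2) / (2 * a) with hk
  have hk1 : 2 * a * k = a ^ 2 + b ^ 2 - c ^ 2 := by rw [hk]; field_simp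
  have hk2 : 0 ≤ b ^ 2 - k ^ 2 := by
    have h1 : k ≤ b := by
      rw [hk, div_le_iff₀ (by positivity)]
      nlinarith
    have h2 : -b ≤ k := by
      rw [hk, le_div_iff₀ (by positivity)]
      nlinarith
    nlinarith
  have hm := Real.sq_sqrt hk2
  set m := √(b ^ 2 - k ^ 2)
  have key : ∀ s t : ℝ, dist ((s / a) • !₂[a, 0]) ((t / b) • (!₂[k, m] : EuclideanSpace ℝ (Fin 2)))
      ^ 2 = (s - t) ^ 2 + s * t / (a * b) * (c ^ 2 - (a - b) ^ 2) := by
    intro s t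
    rw [EuclideanSpace.dist_eq, Real.sq_sqrt (by positivity)]
    simp only [Fin.sum_univ_two, Real.dist_eq, sq_abs, PiLp.smul_apply, smul_eq_mul,
      Matrix.cons_val_zero, Matrix.cons_val_one, mul_zero, zero_sub]
    have hc2 : c ^ 2 = a ^ 2 + b ^ 2 - 2 * a * k := by linarith
    have hm2 : (t / b * m) ^ 2 = (t / b) ^ 2 * (b ^ 2 - k ^ 2) := by rw [mul_pow, hm]
    rw [neg_sq, hm2, hc2]
    field_simp
    ring
  refine ⟨!₂[a, 0], !₂[k, m], ?_, ?_, ?_, key⟩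
  · rw [EuclideanSpace.dist_eq]
    simp [Fin.sum_univ_two, Real.dist_eq, Real.sqrt_sq_eq_abs, abs_of_pos ha]
  · have := key 0 b
    rw [div_self hb.ne', one_smul, zero_div, zero_smul] at this
    refine (pow_left_inj₀ dist_nonneg hb.le two_ne_zero).1 (this.trans (by ring))
  · have := key a b
    rw [div_self hb.ne', div_self ha.ne', one_smul, one_smul, div_self (by positivity)] at this
    exact (pow_left_inj₀ dist_nonneg hc two_ne_zero).1 (this.trans (by ring))

theorem sq_dist_sub_dist_le {X : Type*} [MetricSpace X] (p q r : X) :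
    (dist p q - dist p r) ^ 2 ≤ dist q r ^ 2 := by
  have h : |dist p q - dist p r| ≤ dist q r := by
    simpa [dist_comm p] using abs_dist_sub_le q r p
  exact sq_le_sq.2 (by rwa [abs_of_nonneg (dist_nonneg (x := q) (y := r))])

namespace IsCAT0

variable {X : Type*} [MetricSpace X]

/-- The CAT(0) inequality in coordinates: the right-hand side is the squared distance of the
comparison points, by the law of cosines. It is written so that its two summands are
nonnegative, which makes its monotonicity in `s * t` visible. -/
theorem dist_sq_le (hX : IsCAT0 X) {p q r : X} {γ δ : ℝ → X} (hγ : IsGeodesicPath γ p q)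
    (hδ : IsGeodesicPath δ p r) (hq : 0 < dist p q) (hr : 0 < dist p r) {s t : ℝ}
    (hs : s ∈ Icc 0 (dist p q)) (ht : t ∈ Icc 0 (dist p r)) :
    dist (γ s) (δ t) ^ 2 ≤ (s - t) ^ 2 +
      s * t / (dist p q * dist p r) * (dist q r ^ 2 - (dist p q - dist p r) ^ 2) := by
  obtain ⟨u, v, hu, hv, huv, h⟩ := exists_comparison_triangle hq hr (dist_nonneg (x := q) (y := r))
    (sq_dist_sub_dist_le p q r) (dist_triangle_left q r p)
  have := hX.comparison p q r γ δ hγ hδ 0 u v hu hv huv s hs t ht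
  simp only [AffineMap.lineMap_apply, vsub_eq_sub, sub_zero, vadd_eq_add, add_zero] at this
  rw [← h]
  gcongr

/-! ### Radial projections -/

variable {x x' : X} {r s t : ℝ} {y z : X}

/-- Every point is sent by `π_s` to a point of a geodesic issuing from the centre. -/
theorem exists_radialProj_eq (hX : IsCAT0 X) (x : X) (hs : 0 ≤ s) (y : X) :
    ∃ γ : ℝ → X, IsGeodesicPath γ x y ∧ radialProj x s y = γ (min s (dist x y)) := by
  obtain ⟨γ, hγ⟩ := hX.exists_geodesic x y
  refine ⟨γ, hγ, ?_⟩
  rcases le_or_gt (dist x y) s with h | h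
  · rw [radialProj_of_le h, min_eq_right h, hγ.2.1]
  · rw [hX.radialProj_eq hs h hγ, min_eq_left h.le]

theorem dist_radialProj (hX : IsCAT0 X) (hs : 0 ≤ s) :
    dist x (radialProj x s y) = min s (dist x y) := by
  obtain ⟨γ, hγ, h⟩ := hX.exists_radialProj_eq x hs y
  rw [h, hγ.dist_left ⟨le_min hs dist_nonneg, min_le_right _ _⟩]

theorem dist_radialProj_self (hX : IsCAT0 X) (hs : 0 ≤ s) :
    dist (radialProj x s y) y = dist x y - min s (dist x y) := by
  obtain ⟨γ, hγ, h⟩ := hX.exists_radialProj_eq x hs y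
  rw [h, hγ.dist_right ⟨le_min hs dist_nonneg, min_le_right _ _⟩]

theorem radialProj_radialProj (hX : IsCAT0 X) (hs : 0 ≤ s) (hst : s ≤ t) :
    radialProj x s (radialProj x t y) = radialProj x s y := by
  rcases le_or_gt (dist x y) t with h | h
  · rw [radialProj_of_le h]
  obtain ⟨γ, hγ⟩ := hX.exists_geodesic x y
  have ht : t ∈ Icc 0 (dist x y) := ⟨hs.trans hst, h.le⟩
  rw [hX.radialProj_eq (hs.trans hst) h hγ, hX.radialProj_eq hs (hst.trans_lt h) hγ]
  have hd := hγ.dist_left ht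
  rcases hst.eq_or_lt with rfl | hlt
  · rw [radialProj_of_le hd.le]
  · exact hX.radialProj_eq hs (hd.symm ▸ hlt) (hγ.restrict ht)

/-- Radial projection contracts distances far away from the centre. -/
theorem dist_radialProj_le_mul (hX : IsCAT0 X) (hs : 0 < s) {M : ℝ} (hsM : s ≤ M)
    (hy : M ≤ dist x y) (hz : M ≤ dist x z) :
    dist (radialProj x s y) (radialProj x s z) ≤ s / M * dist y z := by
  obtain ⟨γ, hγ, h1⟩ := hX.exists_radialProj_eq x hs.le y
  obtain ⟨δ, hδ, h2⟩ := hX.exists_radialProj_eq x hs.le z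
  have hM : 0 < M := hs.trans_le hsM
  have hy0 := hM.trans_le hy
  have hz0 := hM.trans_le hz
  rw [h1, h2, min_eq_left (hsM.trans hy), min_eq_left (hsM.trans hz)]
  have := hX.dist_sq_le hγ hδ hy0 hz0 ⟨hs.le, hsM.trans hy⟩ ⟨hs.le, hsM.trans hz⟩
  refine (pow_le_pow_iff_left₀ dist_nonneg (by positivity) two_ne_zero).1 (this.trans ?_)
  calc (s - s) ^ 2 + s * s / (dist x y * dist x z) * (dist y z ^ 2 - (dist x y - dist x z) ^ 2)
      ≤ s * s / (M * M) * dist y z ^ 2 := by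
        rw [sub_self, zero_pow two_ne_zero, zero_add]
        have := sub_nonneg.2 (sq_dist_sub_dist_le x y z)
        gcongr
        nlinarith [sq_nonneg (dist x y - dist x z)]
    _ = (s / M * dist y z) ^ 2 := by ring

/-- `π_s` is 1-Lipschitz. If only `y` lies outside the ball, the two summands of the CAT(0)
inequality are compared with those of `d(y, z)² = (a - b)² + (d(y, z)² - (a - b)²)`, where `a` and
`b` are the distances of `y` and `z` from the centre. -/
theorem dist_radialProj_le (hX : IsCAT0 X) (hs : 0 < s) :
    dist (radialProj x s y) (radialProj x s z) ≤ dist y z := by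
  wlog hyz : dist x z ≤ dist x y generalizing y z
  · rw [dist_comm, dist_comm y]
    exact this (le_of_not_ge hyz)
  rcases le_or_gt (dist x y) s with hy | hy
  · rw [radialProj_of_le hy, radialProj_of_le (hyz.trans hy)]
  rcases le_or_gt s (dist x z) with hz | hz
  · simpa [div_self hs.ne'] using hX.dist_radialProj_le_mul hs le_rfl hy.le hz
  rw [radialProj_of_le hz.le]
  rcases (dist_nonneg (x := x) (y := z)).eq_or_lt with h0 | h0
  · have hxz : x = z := dist_eq_zero.1 h0.symm
    rw [← hxz, dist_comm, hX.dist_radialProj hs.le, dist_comm y]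
    exact min_le_right _ _
  obtain ⟨γ, hγ⟩ := hX.exists_geodesic x y
  obtain ⟨δ, hδ⟩ := hX.exists_geodesic x z
  rw [hX.radialProj_eq hs.le hy hγ, ← hδ.2.1]
  have := hX.dist_sq_le hγ hδ (hs.trans hy) h0 ⟨hs.le, hy.le⟩ ⟨h0.le, le_rfl⟩
  rw [hδ.2.1] at this ⊢
  refine (pow_le_pow_iff_left₀ dist_nonneg dist_nonneg two_ne_zero).1 (this.trans ?_)
  have hn := sub_nonneg.2 (sq_dist_sub_dist_le x y z)
  have h1 : s * dist x z / (dist x y * dist x z) ≤ 1 := by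
    rw [div_le_one (mul_pos (hs.trans hy) h0)]
    gcongr
  nlinarith [mul_le_mul_of_nonneg_right h1 hn]

/-- Moving the centre moves the radial projections by at most the same amount: this is the
convexity of the metric along the geodesics from `z` to the two centres. -/
theorem dist_radialProj_radialProj_le (hX : IsCAT0 X) (hs : 0 ≤ s) :
    dist (radialProj x s z) (radialProj x' s z) ≤ dist x x' := by
  wlog h : dist x z ≤ dist x' z generalizing x x'
  · rw [dist_comm, dist_comm x]
    exact this (le_of_not_ge h)
  rcases le_or_gt (dist x z) s with hz | hz
  · rw [radialProj_of_le hz, dist_comm, hX.dist_radialProj_self hs]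
    have := dist_triangle_left x' z x
    rcases le_total s (dist x' z) with h' | h'
    · rw [min_eq_left h']
      linarith
    · rw [min_eq_right h', sub_self]
      exact dist_nonneg
  have hz' := hz.trans_le h
  obtain ⟨γ, hγ⟩ := hX.exists_geodesic x z
  obtain ⟨δ, hδ⟩ := hX.exists_geodesic x' z
  have h0 := hs.trans_lt hz
  have h0' := hs.trans_lt hz'
  have := hX.dist_sq_le hγ.reverse hδ.reverse (s := dist x z - s) (t := dist x' z - s)
    (by rwa [dist_comm]) (by rwa [dist_comm])
    ⟨by linarith, by rw [dist_comm z]; linarith⟩ ⟨by linarith, by rw [dist_comm z]; linarith⟩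
  rw [hX.radialProj_eq hs hz hγ, hX.radialProj_eq hs hz' hδ]
  simp only [sub_sub_cancel] at this
  refine (pow_le_pow_iff_left₀ dist_nonneg dist_nonneg two_ne_zero).1 (this.trans ?_)
  have hn := sub_nonneg.2 (sq_dist_sub_dist_le z x x')
  simp only [dist_comm z] at hn ⊢
  have h1 : (dist x z - s) * (dist x' z - s) / (dist x z * dist x' z) ≤ 1 := by
    rw [div_le_one (by positivity)]
    apply mul_le_mul <;> linarith
  nlinarith [mul_le_mul_of_nonneg_right h1 hn]

theorem continuous_radialProj (hX : IsCAT0 X) (x : X) (hs : 0 < s) :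
    Continuous (radialProj x s) :=
  (LipschitzWith.of_dist_le_mul (K := 1) fun y z => by
    simpa using hX.dist_radialProj_le hs).continuous

/-- Seen from another point `x'`, a far away point `y` and its projection to a large ball about
`x` have almost the same direction. -/
theorem dist_radialProj_changeCentre_le (hX : IsCAT0 X) {R : ℝ} (hr : 0 < r)
    (hR : r + dist x x' ≤ R) :
    dist (radialProj x' r (radialProj x R y)) (radialProj x' r y) ≤
      r / (R - dist x x') * dist x x' := by
  have hD : (0 : ℝ) ≤ dist x x' := dist_nonneg
  have hRD : r ≤ R - dist x x' := by linarith
  have hrR : r ≤ R := by linarith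
  rcases le_or_gt (dist x y) R with h | h
  · rw [radialProj_of_le h, dist_self]
    have := hr.trans_le hRD
    positivity
  have hR0 := hr.le.trans hrR
  have h1 := hX.dist_radialProj (x := x) (y := y) hR0
  have h2 := hX.dist_radialProj (x := x') (y := y) hR0
  rw [min_eq_left h.le] at h1
  rw [← hX.radialProj_radialProj (x := x') (y := y) hr.le hrR]
  refine (hX.dist_radialProj_le_mul hr hRD ?_ ?_).trans ?_
  · have := dist_triangle x x' (radialProj x R y)
    linarith
  · rw [h2]
    have := dist_triangle x x' y
    exact le_min (by linarith) (by linarith)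
  · have := hr.trans_le hRD
    gcongr
    exact hX.dist_radialProj_radialProj_le hR0

theorem smul_radialProj (hX : IsCAT0 X) {G : Type*} [Group G] [MulAction G X]
    [IsIsometricSMul G X] (g : G) (hs : 0 ≤ s) :
    g • radialProj x s y = radialProj (g • x) s (g • y) := by
  rcases le_or_gt (dist x y) s with h | h
  · rw [radialProj_of_le h, radialProj_of_le (by simpa using h)]
  obtain ⟨γ, hγ⟩ := hX.exists_geodesic x y
  rw [hX.radialProj_eq hs h hγ, hX.radialProj_eq hs (by simpa using h) (hγ.smul g)]

end IsCAT0

/-! ### The inverse limit of balls -/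

section VisualLimit

variable {X : Type*} [MetricSpace X] {x : X}

namespace IsCAT0

theorem toVisualLimit_mem (hX : IsCAT0 X) (y : X) : toVisualLimit x y ∈ visualLimit x := by
  refine ⟨fun r => ?_, fun r s hsr => hX.radialProj_radialProj s.2.le (Subtype.coe_le_coe.2 hsr.le)⟩
  rw [mem_closedBall, dist_comm, toVisualLimit, hX.dist_radialProj r.2.le]
  exact min_le_left _ _

theorem continuous_toVisualLimit (hX : IsCAT0 X) (x : X) : Continuous (toVisualLimit x) :=
  continuous_pi fun r => hX.continuous_radialProj x r.2

theorem isClosed_visualLimit (hX : IsCAT0 X) (x : X) : IsClosed (visualLimit x) := by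
  simp only [visualLimit, ofPred_and, ofPred_forall]
  refine (isClosed_iInter fun r => isClosed_closedBall.preimage (continuous_apply r)).inter ?_
  exact isClosed_iInter fun r => isClosed_iInter fun s => isClosed_iInter fun _ =>
    isClosed_eq ((hX.continuous_radialProj x s.2).comp (continuous_apply r)) (continuous_apply s)

theorem isClosed_visualBoundary (hX : IsCAT0 X) (x : X) : IsClosed (visualBoundary x) := by
  simp only [visualBoundary, ofPred_and, ofPred_forall]
  exact (hX.isClosed_visualLimit x).inter (isClosed_iInter fun r =>
    isClosed_eq (continuous_const.dist (continuous_apply r)) continuous_const)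

theorem isCompact_visualLimit [ProperSpace X] (hX : IsCAT0 X) (x : X) :
    IsCompact (visualLimit x) :=
  (isCompact_univ_pi fun r : Ioi (0 : ℝ) => isCompact_closedBall x (r : ℝ)).of_isClosed_subset
    (hX.isClosed_visualLimit x) fun _ hc r _ => hc.1 r

/-- A point of the limit with a coordinate inside the open ball comes from that coordinate, since
the bonding maps send the complement of a ball to its bounding sphere. -/
theorem toVisualLimit_eq_of_dist_lt (hX : IsCAT0 X) {c : Ioi (0 : ℝ) → X} (hc : c ∈ visualLimit x)
    {r : Ioi (0 : ℝ)} (hr : dist x (c r) < r) : toVisualLimit x (c r) = c := by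
  funext s
  rcases lt_trichotomy s r with h | rfl | h
  · exact hc.2 r s h
  · exact radialProj_of_le hr.le
  · have h1 := hc.2 s r h
    have h2 := hX.dist_radialProj (x := x) (y := c s) r.2.le
    rw [h1] at h2
    have h3 : dist x (c s) ≤ r := by
      by_contra! h4
      rw [min_eq_left h4.le] at h2
      exact hr.ne h2
    rw [radialProj_of_le h3] at h1
    rw [← h1, toVisualLimit, radialProj_of_le (h3.trans h.le)]

theorem mem_visualBoundary_or_exists_eq (hX : IsCAT0 X) {c : Ioi (0 : ℝ) → X}
    (hc : c ∈ visualLimit x) : c ∈ visualBoundary x ∨ ∃ y, toVisualLimit x y = c := by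
  by_cases h : ∀ r : Ioi (0 : ℝ), dist x (c r) = r
  · exact Or.inl ⟨hc, h⟩
  · push Not at h
    obtain ⟨r, hr⟩ := h
    have : dist x (c r) ≤ r := by simpa [dist_comm] using hc.1 r
    exact Or.inr ⟨c r, hX.toVisualLimit_eq_of_dist_lt hc (this.lt_of_ne hr)⟩

end IsCAT0

theorem toVisualLimit_apply_of_le {y : X} {r : Ioi (0 : ℝ)} (h : dist x y ≤ r) :
    toVisualLimit x y r = y :=
  radialProj_of_le h

theorem toVisualLimit_notMem_visualBoundary (x y : X) :
    toVisualLimit x y ∉ visualBoundary x := fun h => by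
  have hpos : (0 : ℝ) < dist x y + 1 := by positivity
  have := h.2 ⟨dist x y + 1, hpos⟩
  rw [toVisualLimit_apply_of_le (by simp)] at this
  simp at this

theorem toVisualLimit_injective (x : X) : Function.Injective (toVisualLimit x) := by
  intro y z h
  have hpos : (0 : ℝ) < max (dist x y) (dist x z) + 1 := by positivity
  have := congrFun h ⟨_, hpos⟩
  rwa [toVisualLimit_apply_of_le (by simpa using (le_max_left _ _).trans (lt_add_one _).le),
    toVisualLimit_apply_of_le (by simpa using (le_max_right _ _).trans (lt_add_one _).le)] at this

/-! ### The space `X +_f ∂X` as the inverse limit of balls -/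

/-- The identification of `X +_f ∂X` with the inverse limit of the balls about `x`, as a map into
the product of which that limit is a subset. -/
noncomputable def sumToLimit (x : X) : SumSpace (visualMap x) → Ioi (0 : ℝ) → X :=
  Sum.elim (toVisualLimit x) Subtype.val

theorem sumToLimit_injective (x : X) : Function.Injective (sumToLimit x) := by
  refine Function.Injective.sumElim (toVisualLimit_injective x) Subtype.val_injective ?_
  exact fun y ξ h => toVisualLimit_notMem_visualBoundary x y (h ▸ ξ.2)

theorem IsCAT0.range_sumToLimit (hX : IsCAT0 X) (x : X) :
    range (sumToLimit x) = visualLimit x := by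
  apply Subset.antisymm
  · rintro _ ⟨y | ξ, rfl⟩
    · exact hX.toVisualLimit_mem y
    · exact ξ.2.1
  · intro c hc
    rcases hX.mem_visualBoundary_or_exists_eq hc with h | ⟨y, hy⟩
    · exact ⟨Sum.inr ⟨c, h⟩, rfl⟩
    · exact ⟨Sum.inl y, hy⟩

/-- The topology of `X +_f ∂X` is that of the inverse limit. -/
theorem IsCAT0.isClosedEmbedding_sumToLimit (hX : IsCAT0 X) (x : X) :
    IsClosedEmbedding (sumToLimit x) := by
  refine .of_continuous_injective_isClosedMap ?_ (sumToLimit_injective x) ?_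
  · refine continuous_iff_isClosed.2 fun B hB => (SumSpace.isClosed_iff _).2 ?_
    refine ⟨hB.preimage (hX.continuous_toVisualLimit x), hB.preimage continuous_subtype_val, ?_⟩
    exact fun ξ hξ => closure_minimal (image_subset_iff.2 Subset.rfl) hB hξ
  · intro A hA
    obtain ⟨h1, h2, h3⟩ := (SumSpace.isClosed_iff _).1 hA
    have himage : sumToLimit x '' A = toVisualLimit x '' (SumSpace.inl (visualMap x) ⁻¹' A) ∪
        Subtype.val '' (SumSpace.inr (visualMap x) ⁻¹' A) := by
      ext c
      constructor
      · rintro ⟨y | ξ, h, rfl⟩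
        · exact Or.inl ⟨y, h, rfl⟩
        · exact Or.inr ⟨ξ, h, rfl⟩
      · rintro (⟨y, h, rfl⟩ | ⟨ξ, h, rfl⟩)
        · exact ⟨_, h, rfl⟩
        · exact ⟨_, h, rfl⟩
    refine isClosed_of_closure_subset fun c hc => ?_
    have hcV : c ∈ visualLimit x :=
      closure_minimal (hX.range_sumToLimit x ▸ image_subset_range _ _)
        (hX.isClosed_visualLimit x) hc
    rw [himage, closure_union,
      ((hX.isClosed_visualBoundary x).isClosedEmbedding_subtypeVal.isClosedMap _ h2).closure_eq]
      at hc
    rw [himage]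
    rcases hc with hc | hc
    swap
    · exact Or.inr hc
    rcases hX.mem_visualBoundary_or_exists_eq hcV with h | ⟨y, rfl⟩
    · exact Or.inr ⟨⟨c, h⟩, h3 hc, rfl⟩
    · -- Near a point of `X`, evaluation at a large radius inverts the embedding of `X`.
      left
      let r : Ioi (0 : ℝ) := ⟨dist x y + 1, add_pos_of_nonneg_of_pos dist_nonneg one_pos⟩
      have hy : toVisualLimit x y r = y := toVisualLimit_apply_of_le (lt_add_one _).le
      have hU : IsOpen {c' : Ioi (0 : ℝ) → X | dist x (c' r) < r} :=
        isOpen_lt (continuous_const.dist (continuous_apply r)) continuous_const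
      have hcU : toVisualLimit x y ∈ {c' : Ioi (0 : ℝ) → X | dist x (c' r) < r} := by
        rw [mem_ofPred_eq, hy]
        exact lt_add_one _
      have hmem := mem_closure_image (continuous_apply r).continuousAt
        (hU.closure_inter ⟨hc, hcU⟩)
      refine ⟨y, ?_, rfl⟩
      rw [hy] at hmem
      refine closure_minimal ?_ h1 hmem
      rintro _ ⟨_, ⟨⟨z, hz, rfl⟩, hzr⟩, rfl⟩
      have hzr' : dist x (radialProj x r z) < r := hzr
      rw [hX.dist_radialProj r.2.le, min_lt_iff] at hzr'
      have hz' : toVisualLimit x z r = z :=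
        toVisualLimit_apply_of_le (hzr'.resolve_left (lt_irrefl _)).le
      change toVisualLimit x z r ∈ SumSpace.inl (visualMap x) ⁻¹' A
      rwa [hz']

theorem IsCAT0.compactSpace_sumSpace [ProperSpace X] (hX : IsCAT0 X) (x : X) :
    CompactSpace (SumSpace (visualMap x)) := by
  rw [← isCompact_univ_iff, (hX.isClosedEmbedding_sumToLimit x).isInducing.isCompact_iff,
    image_univ, hX.range_sumToLimit]
  exact hX.isCompact_visualLimit x

theorem IsCAT0.t2Space_sumSpace (hX : IsCAT0 X) (x : X) : T2Space (SumSpace (visualMap x)) :=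
  (hX.isClosedEmbedding_sumToLimit x).isEmbedding.t2Space

theorem IsCAT0.compactSpace_visualBoundary [ProperSpace X] (hX : IsCAT0 X) (x : X) :
    CompactSpace (visualBoundary x) :=
  isCompact_iff_compactSpace.1 <| (hX.isCompact_visualLimit x).of_isClosed_subset
    (hX.isClosed_visualBoundary x) fun _ hc => hc.1

/-! ### Boundary points and bounded perturbations -/

theorem IsCAT0.tendsto_dist_atTop (hX : IsCAT0 X) {ι : Type*} {l : Filter ι} {a : ι → X}
    {ξ : Ioi (0 : ℝ) → X} (hξ : ξ ∈ visualBoundary x)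
    (ha : Tendsto (fun i => toVisualLimit x (a i)) l (𝓝 ξ)) :
    Tendsto (fun i => dist x (a i)) l atTop := by
  refine tendsto_atTop.2 fun M => ?_
  have hpos : (0 : ℝ) < |M| + 1 := by positivity
  have h := (tendsto_const_nhds (x := x)).dist (tendsto_pi_nhds.1 ha ⟨_, hpos⟩)
  rw [hξ.2] at h
  filter_upwards [h.eventually_const_lt (lt_of_le_of_lt (le_abs_self M) (lt_add_one _))] with i hi
  rw [toVisualLimit, hX.dist_radialProj hpos.le] at hi
  exact (hi.trans_le (min_le_right _ _)).le

/-- Points far away from `x` that stay at bounded distance from each other are seen from `x` in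
almost the same direction. -/
theorem IsCAT0.tendsto_dist_radialProj (hX : IsCAT0 X) {ι : Type*} {l : Filter ι} {a b : ι → X}
    {C : ℝ} (hab : ∀ᶠ i in l, dist (a i) (b i) ≤ C)
    (ha : Tendsto (fun i => dist x (a i)) l atTop) {r : ℝ} (hr : 0 < r) :
    Tendsto (fun i => dist (radialProj x r (a i)) (radialProj x r (b i))) l (𝓝 0) := by
  have hM : Tendsto (fun i => dist x (a i) - C) l atTop := tendsto_atTop_add_const_right _ _ ha
  refine squeeze_zero' (Eventually.of_forall fun _ => dist_nonneg) ?_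
    (by simpa using (hM.const_div_atTop r).mul_const C)
  filter_upwards [hab, hM.eventually_ge_atTop r] with i hi hri
  have h1 := dist_triangle_right x (a i) (b i)
  have h2 := dist_nonneg.trans hi
  refine (hX.dist_radialProj_le_mul hr hri (by linarith) (by linarith)).trans ?_
  have := hr.trans_le hri
  gcongr

theorem IsCAT0.tendsto_toVisualLimit_of_dist_le (hX : IsCAT0 X) {ι : Type*} {l : Filter ι}
    {a b : ι → X} {C : ℝ} {ξ : Ioi (0 : ℝ) → X} (hξ : ξ ∈ visualBoundary x)
    (hab : ∀ᶠ i in l, dist (a i) (b i) ≤ C)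
    (ha : Tendsto (fun i => toVisualLimit x (a i)) l (𝓝 ξ)) :
    Tendsto (fun i => toVisualLimit x (b i)) l (𝓝 ξ) :=
  tendsto_pi_nhds.2 fun r => (tendsto_iff_of_dist
    (hX.tendsto_dist_radialProj hab (hX.tendsto_dist_atTop hξ ha) r.2)).1 (tendsto_pi_nhds.1 ha r)

/-- The boundary points in the closure of `A` only depend on `A` up to bounded distance. -/
theorem IsCAT0.visualMap_le_of_dist_le (hX : IsCAT0 X) {A B : Closeds X} {C : ℝ}
    (h : ∀ a ∈ A, ∃ b ∈ B, dist a b ≤ C) : visualMap x A ≤ visualMap x B := by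
  intro ξ hξ
  choose! σ hσ using h
  have hfreq : ∃ᶠ y in comap (toVisualLimit x) (𝓝 ξ.1), y ∈ A := by
    refine frequently_comap.2 ((mem_closure_iff_frequently.1 hξ).mono ?_)
    rintro _ ⟨y, hy, rfl⟩
    exact ⟨y, rfl, hy⟩
  have hne := frequently_mem_iff_neBot.1 hfreq
  have hA : ∀ᶠ y in comap (toVisualLimit x) (𝓝 ξ.1) ⊓ 𝓟 (A : Set X), y ∈ A :=
    mem_inf_of_right (mem_principal_self _)
  refine mem_closure_of_tendsto (hX.tendsto_toVisualLimit_of_dist_le ξ.2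
    (hA.mono fun y hy => (hσ y hy).2) (tendsto_comap.mono_left inf_le_left)) ?_
  exact hA.mono fun y hy => mem_image_of_mem _ (hσ y hy).1

end VisualLimit

/-! ### The action on the boundary -/

section BoundaryAction

variable {G X : Type*} [Group G] [MetricSpace X] [MulAction G X] [IsIsometricSMul G X] {x : X}

namespace IsCAT0

/-- The sequences whose limits define the extension of `g` are Cauchy, uniformly in `c`: as
`g • c R` is the projection of `g • c S` to a ball about `g • x`, this is the change of centre
from `g • x` to `x`. -/
theorem dist_radialProj_smul_le (hX : IsCAT0 X) (g : G) {c : Ioi (0 : ℝ) → X}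
    (hc : c ∈ visualLimit x) {r : ℝ} (hr : 0 < r) {R S : Ioi (0 : ℝ)}
    (hR : r + dist (g • x) x ≤ R) (hRS : R ≤ S) :
    dist (radialProj x r (g • c R)) (radialProj x r (g • c S)) ≤
      r / (R - dist (g • x) x) * dist (g • x) x := by
  rcases hRS.eq_or_lt with rfl | hlt
  · rw [dist_self]
    have : 0 < (R : ℝ) - dist (g • x) x := by linarith
    positivity
  rw [← hc.2 S R hlt, hX.smul_radialProj g R.2.le]
  exact hX.dist_radialProj_changeCentre_le hr hR

theorem tendsto_error_bound (r D : ℝ) :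
    Tendsto (fun n : ℕ => r / ((n : ℝ) + 1 - D) * D) atTop (𝓝 0) := by
  have h : Tendsto (fun n : ℕ => (n : ℝ) + 1 - D) atTop atTop :=
    tendsto_atTop_add_const_right _ _
      (tendsto_atTop_add_const_right _ _ tendsto_natCast_atTop_atTop)
  simpa using (h.const_div_atTop r).mul_const D

/-- The radius `n + 1`, as an index of the inverse limit. -/
def natRadius (n : ℕ) : Ioi (0 : ℝ) := ⟨n + 1, mem_Ioi.2 n.cast_add_one_pos⟩

theorem exists_limit_radialProj_smul [CompleteSpace X] (hX : IsCAT0 X) (g : G)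
    {c : Ioi (0 : ℝ) → X} (hc : c ∈ visualLimit x) {r : ℝ} (hr : 0 < r) :
    ∃ z, Tendsto (fun n => radialProj x r (g • c (natRadius n))) atTop (𝓝 z) ∧
      ∀ n : ℕ, r + dist (g • x) x ≤ n + 1 → dist (radialProj x r (g • c (natRadius n))) z ≤
        r / (n + 1 - dist (g • x) x) * dist (g • x) x := by
  have hmono : ∀ n m : ℕ, n ≤ m → natRadius n ≤ natRadius m := fun n m h => by
    have : (n : ℝ) ≤ m := Nat.cast_le.2 h
    exact Subtype.coe_le_coe.1 (by simpa [natRadius] using this)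
  have hest : ∀ n m : ℕ, r + dist (g • x) x ≤ n + 1 → n ≤ m →
      dist (radialProj x r (g • c (natRadius n))) (radialProj x r (g • c (natRadius m))) ≤
        r / (n + 1 - dist (g • x) x) * dist (g • x) x := fun n m hn hnm =>
    hX.dist_radialProj_smul_le g hc hr hn (hmono n m hnm)
  -- The estimate is available from the index `N` on.
  obtain ⟨N, hN⟩ := exists_nat_ge (r + dist (g • x) x)
  have hN' : ∀ k : ℕ, r + dist (g • x) x ≤ ((k + N : ℕ) : ℝ) + 1 := fun k => by
    push_cast
    have : (0 : ℝ) ≤ k := k.cast_nonneg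
    linarith
  have hcauchy : CauchySeq fun k : ℕ => radialProj x r (g • c (natRadius (k + N))) := by
    refine cauchySeq_of_le_tendsto_0'
      (fun k : ℕ => r / (((k + N : ℕ) : ℝ) + 1 - dist (g • x) x) * dist (g • x) x) ?_ ?_
    · exact fun k m hkm => hest _ _ (hN' k) (by omega)
    · exact (tendsto_error_bound r _).comp (tendsto_add_atTop_nat N)
  obtain ⟨z, hz⟩ := cauchySeq_tendsto_of_complete hcauchy
  have hz' := (tendsto_add_atTop_iff_nat (f := fun n => radialProj x r (g • c (natRadius n))) N).1 hz
  refine ⟨z, hz', fun n hn => ?_⟩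
  refine le_of_tendsto (tendsto_const_nhds.dist hz') ?_
  filter_upwards [eventually_ge_atTop n] with m hm using hest n m hn hm

theorem eventually_lt_natRadius (r : Ioi (0 : ℝ)) : ∀ᶠ n : ℕ in atTop, r < natRadius n := by
  filter_upwards [tendsto_natCast_atTop_atTop.eventually_gt_atTop (r : ℝ)] with n hn
  exact Subtype.coe_lt_coe.1 (hn.trans (lt_add_one _))

/-- The points of a ray, or of a geodesic segment continued by its endpoint, converge to the point
of the limit which it represents. -/
theorem tendsto_toVisualLimit {c : Ioi (0 : ℝ) → X} (hc : c ∈ visualLimit x) :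
    Tendsto (fun n => toVisualLimit x (c (natRadius n))) atTop (𝓝 c) := by
  refine tendsto_pi_nhds.2 fun r => tendsto_const_nhds.congr' ?_
  filter_upwards [eventually_lt_natRadius r] with n hn using (hc.2 _ _ hn).symm

theorem denseRange_toVisualLimit (hX : IsCAT0 X) (x : X) :
    DenseRange fun y => (⟨toVisualLimit x y, hX.toVisualLimit_mem y⟩ : visualLimit x) := fun c =>
  mem_closure_of_tendsto (tendsto_subtype_rng.2 (tendsto_toVisualLimit c.2))
    (Eventually.of_forall fun n => mem_range_self (c.1 (natRadius n)))

/-- An isometry extends continuously to the inverse limit of balls, moving rays to asymptotic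
rays. The extension is the uniform limit of the maps `c ↦ π_r (g • c n)`. -/
theorem exists_extension [CompleteSpace X] (hX : IsCAT0 X) (x : X) (g : G) :
    ∃ A : visualLimit x → visualLimit x, Continuous A ∧
      (∀ y, A ⟨toVisualLimit x y, hX.toVisualLimit_mem y⟩ =
        ⟨toVisualLimit x (g • y), hX.toVisualLimit_mem (g • y)⟩) ∧
      ∀ (c : visualLimit x) (r : Ioi (0 : ℝ)), dist (g • c.1 r) ((A c).1 r) ≤ dist (g • x) x := by
  have h := fun (c : visualLimit x) (r : Ioi (0 : ℝ)) =>
    hX.exists_limit_radialProj_smul g c.2 r.2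
  choose A hA hbound using h
  have hlim : ∀ c : visualLimit x,
      Tendsto (fun n => toVisualLimit x (g • c.1 (natRadius n))) atTop (𝓝 (A c)) :=
    fun c => tendsto_pi_nhds.2 fun r => hA c r
  refine ⟨fun c => ⟨A c, (hX.isClosed_visualLimit x).mem_of_tendsto (hlim c)
    (Eventually.of_forall fun _ => hX.toVisualLimit_mem _)⟩, ?_, ?_, ?_⟩
  · refine Continuous.subtype_mk (continuous_pi fun r => ?_) _
    have hunif : TendstoUniformly
        (fun (n : ℕ) (c : visualLimit x) => radialProj x r (g • c.1 (natRadius n)))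
        (fun c => A c r) atTop := by
      refine Metric.tendstoUniformly_iff.2 fun ε hε => ?_
      have hlarge : ∀ᶠ n : ℕ in atTop, (r : ℝ) + dist (g • x) x ≤ n + 1 := by
        filter_upwards [tendsto_natCast_atTop_atTop.eventually_ge_atTop
          ((r : ℝ) + dist (g • x) x)] with n hn using hn.trans (lt_add_one _).le
      filter_upwards [hlarge, (tendsto_error_bound (r : ℝ) (dist (g • x) x)).eventually_lt_const hε]
        with n hn hnε c
      rw [dist_comm]
      exact (hbound c r n hn).trans_lt hnε
    refine hunif.continuous (Eventually.of_forall fun n => ?_).frequently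
    exact (hX.continuous_radialProj x r.2).comp ((continuous_const_smul g).comp
      ((continuous_apply (natRadius n)).comp continuous_subtype_val))
  · intro y
    refine Subtype.ext (tendsto_nhds_unique (hlim _) (tendsto_const_nhds.congr' ?_))
    filter_upwards [tendsto_natCast_atTop_atTop.eventually_ge_atTop (dist x y)] with n hn
    rw [toVisualLimit_apply_of_le (hn.trans (lt_add_one _).le)]
  · intro c r
    refine le_of_tendsto (tendsto_const_nhds.dist (hA c r)) ?_
    filter_upwards [eventually_lt_natRadius r] with n hn
    rw [← c.2.2 _ _ hn, hX.smul_radialProj g r.2.le]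
    exact hX.dist_radialProj_radialProj_le r.2.le

/-- The action on the visual boundary: it moves rays to asymptotic rays, and it is compatible with
the action on `X` as far as closures of subsets of `X` are concerned. -/
theorem exists_boundary_action [CompleteSpace X] (hX : IsCAT0 X) (x : X) :
    ∃ ψ : G →* (visualBoundary x ≃ₜ visualBoundary x),
      (∀ (g : G) (ξ : visualBoundary x) (r : Ioi (0 : ℝ)),
        dist (g • ξ.1 r) ((ψ g ξ).1 r) ≤ dist (g • x) x) ∧
      ∀ (g : G) (A B : Closeds X), (∀ a ∈ A, g • a ∈ B) →
        ∀ ξ ∈ visualMap x A, ψ g ξ ∈ visualMap x B := by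
  choose A hA hAX hAdist using fun g : G => hX.exists_extension x g
  have hmul : ∀ g h, A (g * h) = A g ∘ A h := fun g h =>
    (hX.denseRange_toVisualLimit x).equalizer (hA _) ((hA g).comp (hA h)) <| by
      funext y
      simp only [Function.comp_apply, hAX, mul_smul]
  have hone : A 1 = id :=
    (hX.denseRange_toVisualLimit x).equalizer (hA _) continuous_id <| by
      funext y
      simp only [Function.comp_apply, hAX, one_smul, id]
  have hinv : ∀ g c, A g⁻¹ (A g c) = c := fun g c => by
    rw [← Function.comp_apply (f := A g⁻¹), ← hmul, inv_mul_cancel, hone, id]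
  have hbd : ∀ g (ξ : visualBoundary x), (A g ⟨ξ.1, ξ.2.1⟩).1 ∈ visualBoundary x := by
    intro g ξ
    -- `A g` maps only `X` to `X`, as its inverse `A g⁻¹` preserves `X`.
    refine (hX.mem_visualBoundary_or_exists_eq (A g ⟨ξ.1, ξ.2.1⟩).2).resolve_right ?_
    rintro ⟨y, hy⟩
    have h1 := hinv g ⟨ξ.1, ξ.2.1⟩
    rw [← Subtype.coe_eta (A g ⟨ξ.1, ξ.2.1⟩) (A g ⟨ξ.1, ξ.2.1⟩).2] at h1
    simp only [← hy] at h1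
    rw [hAX] at h1
    have h2 : toVisualLimit x (g⁻¹ • y) = ξ.1 := congrArg Subtype.val h1
    exact toVisualLimit_notMem_visualBoundary x (g⁻¹ • y) (h2 ▸ ξ.2)
  let B : G → visualBoundary x → visualBoundary x := fun g ξ => ⟨A g ⟨ξ.1, ξ.2.1⟩, hbd g ξ⟩
  have hBcont : ∀ g, Continuous (B g) := fun g => Continuous.subtype_mk
    (continuous_subtype_val.comp ((hA g).comp (continuous_subtype_val.subtype_mk _))) _
  have hBone : ∀ ξ, B 1 ξ = ξ := fun ξ => by
    refine Subtype.ext ?_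
    simp only [B, hone, id]
  have hBmul : ∀ g h ξ, B (g * h) ξ = B g (B h ξ) := fun g h ξ => by
    refine Subtype.ext ?_
    simp only [B, hmul, Function.comp_apply, Subtype.coe_eta]
  let ψ : G →* (visualBoundary x ≃ₜ visualBoundary x) :=
    { toFun := fun g =>
        { toFun := B g
          invFun := B g⁻¹
          left_inv := fun ξ => by rw [← hBmul, inv_mul_cancel, hBone]
          right_inv := fun ξ => by rw [← hBmul, mul_inv_cancel, hBone]
          continuous_toFun := hBcont g
          continuous_invFun := hBcont g⁻¹ }
      map_one' := Homeomorph.ext hBone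
      map_mul' := fun g h => Homeomorph.ext (hBmul g h) }
  refine ⟨ψ, fun g ξ r => hAdist g ⟨ξ.1, ξ.2.1⟩ r, fun g S T hST ξ hξ => ?_⟩
  have hmem : (⟨ξ.1, ξ.2.1⟩ : visualLimit x) ∈ closure
      ((fun y => (⟨toVisualLimit x y, hX.toVisualLimit_mem y⟩ : visualLimit x)) '' S) := by
    rw [closure_subtype, image_image]
    exact hξ
  have hcl := mem_closure_image ((continuous_subtype_val.comp (hA g)).continuousAt) hmem
  refine closure_mono ?_ hcl
  rintro _ ⟨_, ⟨y, hy, rfl⟩, rfl⟩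
  exact ⟨g • y, hST y hy, by simp only [Function.comp_apply, hAX]⟩

end IsCAT0

end BoundaryAction

/-! ### Continuous maps between sums of spaces -/

namespace SumSpace

variable {X Y X' Y' : Type*} [TopologicalSpace X] [TopologicalSpace Y] [TopologicalSpace X']
  [TopologicalSpace Y'] {f : AdmissibleMap X Y} {f' : AdmissibleMap X' Y'}

/-- The map `a + b : X +_f Y → X' +_f' Y'` which is `a` on `X` and `b` on `Y`. -/
def sumMap (f : AdmissibleMap X Y) (f' : AdmissibleMap X' Y') (a : X → X') (b : Y → Y') :
    SumSpace f → SumSpace f' :=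
  Sum.map a b

/-- `a + b` is continuous as soon as `a` and `b` are and `f (a⁻¹ A) ⊆ b⁻¹ (f' A)` for closed
`A`. -/
theorem continuous_sumMap {a : X → X'} {b : Y → Y'} (ha : Continuous a) (hb : Continuous b)
    (h : ∀ A : Closeds X', ∀ q ∈ f (A.preimage ha), b q ∈ f' A) :
    Continuous (sumMap f f' a b) := by
  refine continuous_iff_isClosed.2 fun A hA => (isClosed_iff f).2 ?_
  obtain ⟨h1, h2, h3⟩ := (isClosed_iff f').1 hA
  exact ⟨h1.preimage ha, h2.preimage hb, fun q hq => h3 (h ⟨_, h1⟩ q hq)⟩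

theorem isOpen_singleton_inl [DiscreteTopology X] (p : X) : IsOpen {inl f p} := by
  rw [← isClosed_compl_iff, isClosed_iff]
  have huniv : inr f ⁻¹' {inl f p}ᶜ = univ := eq_univ_of_forall fun q h => Sum.inr_ne_inl h
  rw [IsClosedSet, huniv]
  exact ⟨isClosed_discrete _, isClosed_univ, subset_univ _⟩

end SumSpace

/-! ### Perspectivity -/

section Action

variable {G X : Type*} [Group G] [MetricSpace X] [ProperSpace X]
  [MulAction G X] [ProperlyDiscontinuousSMul G X] {x : X}

theorem tendsto_dist_smul_cofinite (x y : X) :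
    Tendsto (fun g : G => dist x (g • y)) cofinite atTop := by
  refine tendsto_atTop.2 fun M => ?_
  have hfin := ProperlyDiscontinuousSMul.finite_disjoint_inter_image (Γ := G)
    (isCompact_singleton (x := y)) (isCompact_closedBall x M)
  refine hfin.subset fun g hg => ?_
  have hg' : ¬ M ≤ dist x (g • y) := hg
  exact ⟨g • y, ⟨y, rfl, rfl⟩, by rw [mem_closedBall, dist_comm]; exact (not_le.1 hg').le⟩

variable [IsIsometricSMul G X]

/-- Translates `g K` of a bounded set become small in the inverse limit of balls. -/
theorem IsCAT0.tendsto_uniformity_smul (hX : IsCAT0 X) (x : X) {K : Set X} (hK : IsCompact K) :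
    Tendsto (fun p : G × X × X => (toVisualLimit x (p.1 • p.2.1), toVisualLimit x (p.1 • p.2.2)))
      (cofinite ×ˢ 𝓟 (K ×ˢ K)) (uniformity (Ioi (0 : ℝ) → X)) := by
  obtain ⟨C, hC⟩ := Metric.isBounded_iff.1 hK.isBounded
  have hKK : ∀ᶠ p : G × X × X in cofinite ×ˢ 𝓟 (K ×ˢ K), p.2 ∈ K ×ˢ K :=
    tendsto_snd.eventually (mem_principal_self _)
  have hdist : Tendsto (fun p : G × X × X => dist x (p.1 • p.2.1)) (cofinite ×ˢ 𝓟 (K ×ˢ K))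
      atTop := by
    rcases K.eq_empty_or_nonempty with rfl | ⟨k, hk⟩
    · simp
    refine tendsto_atTop_mono' _ ?_ (tendsto_atTop_add_const_right _ (-C)
      ((tendsto_dist_smul_cofinite x k).comp tendsto_fst))
    filter_upwards [hKK] with p hp
    have h1 := hC hp.1 hk
    rw [← dist_smul p.1] at h1
    have h2 := dist_triangle x (p.1 • p.2.1) (p.1 • k)
    simp only [Function.comp_apply]
    linarith
  have hclose : ∀ᶠ p : G × X × X in cofinite ×ˢ 𝓟 (K ×ˢ K),
      dist (p.1 • p.2.1) (p.1 • p.2.2) ≤ C := by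
    filter_upwards [hKK] with p hp
    rw [dist_smul]
    exact hC hp.1 hp.2
  rw [Pi.uniformity, tendsto_iInf]
  refine fun r => tendsto_comap_iff.2 (tendsto_uniformity_iff_dist_tendsto_zero.2 ?_)
  exact hX.tendsto_dist_radialProj hclose hdist r.2

variable {ψ : G →* (visualBoundary x ≃ₜ visualBoundary x)}

theorem IsCAT0.isPerspective (hX : IsCAT0 X)
    (hψ : ∀ (g : G) (A B : Closeds X), (∀ a ∈ A, g • a ∈ B) →
        ∀ ξ ∈ visualMap x A, ψ g ξ ∈ visualMap x B) :
    IsPerspective (visualMap x) ψ := by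
  have hcomp := hX.compactSpace_sumSpace x
  have hcont : ∀ g : G, Continuous (SumSpace.map (fun p : X => g • p) (ψ g) :
      SumSpace (visualMap x) → SumSpace (visualMap x)) := fun g =>
    SumSpace.continuous_sumMap (continuous_const_smul g) (ψ g).continuous
      fun A => hψ g _ A fun _ ha => ha
  refine ⟨hX.compactSpace_visualBoundary x, inferInstance, hcomp, hX.t2Space_sumSpace x, ?_, ?_⟩
  · have hinv : ∀ (g h : G), h * g = 1 → Function.LeftInverse
        (SumSpace.map (fun p : X => h • p) (ψ h) :
          SumSpace (visualMap x) → SumSpace (visualMap x))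
        (SumSpace.map (fun p : X => g • p) (ψ g)) := by
      rintro g h hgh (p | ξ)
      · exact congrArg Sum.inl (by simp only [smul_smul, hgh, one_smul])
      · refine congrArg Sum.inr ?_
        rw [← Homeomorph.mul_apply, ← map_mul, hgh, map_one, Homeomorph.one_apply]
    exact fun g => (Homeomorph.mk ⟨_, _, hinv g g⁻¹ (inv_mul_cancel g),
      hinv g⁻¹ g (mul_inv_cancel g)⟩ (hcont g) (hcont g⁻¹)).isHomeomorph
  · intro 𝒰 h𝒰 u hu K hK
    -- The uniform structure of a compact space is unique, so it is induced by the limit of balls.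
    have hunique : 𝒰 = UniformSpace.comap (sumToLimit x) inferInstance :=
      unique_uniformity_of_compact h𝒰 (hX.isClosedEmbedding_sumToLimit x).isInducing.eq_induced.symm
    rw [hunique, uniformity_comap] at hu
    obtain ⟨v, hv, hvu⟩ := hu
    have h := hX.tendsto_uniformity_smul (G := G) x hK hv
    rw [mem_map, mem_prod_principal] at h
    refine Set.Finite.subset h fun g hg hg' => hg fun k hk k' hk' => hvu ?_
    exact hg' (k, k') ⟨hk, hk'⟩

/-- The space `G +_∂ ∂X` maps to `X +_f ∂X` by an orbit map on `G` and the identity on `∂X`. This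
map is proper, and injective on `∂X`. -/
theorem IsCAT0.isPerspectiveGroup [TopologicalSpace G] [DiscreteTopology G] (hX : IsCAT0 X)
    (hψ : ∀ (g : G) (A B : Closeds X), (∀ a ∈ A, g • a ∈ B) →
        ∀ ξ ∈ visualMap x A, ψ g ξ ∈ visualMap x B)
    {K : Set X} (hK : IsCompact K) (hne : K.Nonempty) :
    IsPerspectiveGroup ((visualMap x).comp (translatesMap G K hK)) ψ := by
  obtain ⟨C, hC⟩ := Metric.isBounded_iff.1 hK.isBounded
  obtain ⟨k₀, hk₀⟩ := hne
  have hcompX := hX.compactSpace_sumSpace x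
  have ht2X := hX.t2Space_sumSpace x
  set f := (visualMap x).comp (translatesMap G K hK)
  have hmem : ∀ {F : Closeds G} {p : X},
      p ∈ translatesMap G K hK F ↔ ∃ g ∈ F, ∃ k ∈ K, g • k = p := by
    intro F p
    change p ∈ (⋃ g : (F : Set G), (fun p : X => (g : G) • p) '' K) ↔ _
    simp
  let Θ : SumSpace f → SumSpace (visualMap x) := SumSpace.sumMap _ _ (fun g => g • k₀) id
  have hΘcont : Continuous Θ := by
    refine SumSpace.continuous_sumMap continuous_of_discreteTopology continuous_id fun A ξ hξ => ?_
    refine hX.visualMap_le_of_dist_le (C := C) ?_ hξ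
    intro p hp
    obtain ⟨g, hg, k, hk, rfl⟩ := hmem.1 hp
    exact ⟨g • k₀, hg, by rw [dist_smul]; exact hC hk hk₀⟩
  have hΘclosed : IsClosedMap Θ := by
    intro A hA
    obtain ⟨_, h2, h3⟩ := (SumSpace.isClosed_iff f).1 hA
    have hX' : SumSpace.inl (visualMap x) ⁻¹' (Θ '' A) =
        ⋃ g : (SumSpace.inl f ⁻¹' A), (fun p : X => (g : G) • p) '' {k₀} := by
      ext p
      simp only [image_singleton, mem_iUnion, mem_singleton_iff]
      constructor
      · rintro ⟨g | ξ, h, hp⟩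
        · exact ⟨⟨g, h⟩, (Sum.inl_injective hp).symm⟩
        · cases hp
      · rintro ⟨⟨g, h⟩, rfl⟩
        exact ⟨_, h, rfl⟩
    have hY' : SumSpace.inr (visualMap x) ⁻¹' (Θ '' A) = SumSpace.inr f ⁻¹' A := by
      ext ξ
      constructor
      · rintro ⟨g | η, h, hp⟩
        · cases hp
        · obtain rfl := Sum.inr_injective hp
          exact h
      · exact fun h => ⟨_, h, rfl⟩
    refine (SumSpace.isClosed_iff _).2 ⟨?_, ?_, ?_⟩
    · rw [hX']
      exact isClosed_iUnion_translates isCompact_singleton _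
    · rwa [hY']
    · rw [hY']
      refine Subset.trans ?_ h3
      refine OrderHomClass.mono (visualMap x) fun p hp => ?_
      have hp' : p ∈ SumSpace.inl (visualMap x) ⁻¹' (Θ '' A) := hp
      rw [hX'] at hp'
      obtain ⟨⟨g, hg⟩, q, rfl, rfl⟩ := mem_iUnion.1 hp'
      exact hmem.2 ⟨g, hg, q, hk₀, rfl⟩
  have hfiber : ∀ w, IsCompact (Θ ⁻¹' {w}) := by
    intro w
    refine Set.Finite.isCompact ?_
    rcases w with p | ξ
    · have hfin := ProperlyDiscontinuousSMul.finite_disjoint_inter_image (Γ := G)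
        (isCompact_singleton (x := k₀)) (isCompact_singleton (x := p))
      refine (hfin.image (SumSpace.inl f)).subset ?_
      rintro (g | η) h
      · exact ⟨g, ⟨p, ⟨k₀, rfl, Sum.inl_injective h⟩, rfl⟩, rfl⟩
      · cases h
    · refine (finite_singleton (SumSpace.inr f ξ)).subset ?_
      rintro (g | η) h
      · cases h
      · exact congrArg Sum.inr (Sum.inr_injective h)
  refine ⟨hX.compactSpace_visualBoundary x, inferInstance, ?_, ?_, ?_, ?_⟩
  · have hprop := isProperMap_iff_isClosedMap_and_compact_fibers.2 ⟨hΘcont, hΘclosed, hfiber⟩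
    exact ⟨hprop.isCompact_preimage isCompact_univ⟩
  · refine ⟨fun u v huv => ?_⟩
    -- Points with the same image under `Θ` are isolated points of `G` or equal.
    by_cases hΘ : Θ u = Θ v
    · rcases u with g | ξ <;> rcases v with h | η
      · exact ⟨_, _, SumSpace.isOpen_singleton_inl g, SumSpace.isOpen_singleton_inl h, rfl, rfl,
          disjoint_singleton.2 huv⟩
      · cases hΘ
      · cases hΘ
      · exact absurd (congrArg Sum.inr (Sum.inr_injective hΘ)) huv
    · exact separated_by_continuous hΘcont hΘ
  · refine continuous_prod_of_discrete_left.2 fun g => ?_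
    refine SumSpace.continuous_sumMap (a := fun h : G => g * h) continuous_of_discreteTopology
      (ψ g).continuous fun A => hψ g _ _ ?_
    intro p hp
    obtain ⟨h, hh, k, hk, rfl⟩ := hmem.1 hp
    exact hmem.2 ⟨g * h, hh, k, hk, mul_smul _ _ _⟩
  · refine continuous_prod_of_discrete_left.2 fun h => ?_
    refine SumSpace.continuous_sumMap (a := fun g : G => g * h) continuous_of_discreteTopology
      continuous_id fun A ξ hξ => ?_
    refine hX.visualMap_le_of_dist_le (C := C + dist k₀ (h • k₀)) ?_ hξ
    intro p hp
    obtain ⟨g, hg, k, hk, rfl⟩ := hmem.1 hp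
    refine ⟨(g * h) • k₀, hmem.2 ⟨g * h, hg, k₀, hk₀, rfl⟩, ?_⟩
    rw [mul_smul, dist_smul]
    exact (dist_triangle _ k₀ _).trans (add_le_add (hC hk hk₀) le_rfl)

end Action

theorem mainTheorem5 {G X : Type*} [Group G] [TopologicalSpace G] [DiscreteTopology G]
    [MetricSpace X] [ProperSpace X] (hX : IsCAT0 X)
    [MulAction G X] [IsIsometricSMul G X] [ProperlyDiscontinuousSMul G X]
    (hcocompact : ∃ K : Set X, IsCompactFundamentalDomain G K) (x : X) :
    ∃ ψ : G →* (visualBoundary x ≃ₜ visualBoundary x),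
      (∀ (g : G) (ξ : visualBoundary x), ∃ C : ℝ, ∀ r : Set.Ioi (0 : ℝ),
        dist (g • ξ.1 r) ((ψ g ξ).1 r) ≤ C) ∧
      IsPerspective (visualMap x) ψ ∧
      ∀ (K : Set X) (hK : IsCompactFundamentalDomain G K),
        IsPerspectiveGroup ((visualMap x).comp (translatesMap G K hK.1)) ψ := by
  obtain ⟨ψ, hdist, hψ⟩ := hX.exists_boundary_action (G := G) x
  refine ⟨ψ, fun g ξ => ⟨_, hdist g ξ⟩, hX.isPerspective hψ, fun K hK => ?_⟩
  obtain ⟨g, k, hk, -⟩ := hK.2 x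
  exact hX.isPerspectiveGroup hψ hK.1 ⟨k, hk⟩
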